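/- Let $L$ be a link diagram on the sphere $S^2$ (a generic projection of a link, possibly disconnected or with components without crossings; an orientation of the link plays no role), with finite set of crossings $X$ and set of faces $F$, the faces being the components of the complement of the projection. Let $\mathbb F_L$ be the field of fractions of $\mathbb Z/2[x_f : f\in F]$, and for a set $R$ of faces put $[R]=\sum_{f\in R}x_f\in\mathbb F_L$. For $S\subseteq X$ let $L_S$ be the resolution obtained by giving the crossings in $S$ their $1$-resolution and all other crossings their $0$-resolution; the faces of $L$ correspond to the pieces into which the resolution arcs cut the regions of $S^2\setminus L_S$. Let $O(L)$ be the set of $S\subseteq X$ such that $L_S$ is a single circle, and $O_i(L)=\{S\in O(L): |S|=i\}$ for $i\in\mathbb Z$. Let $p$ be a marked point on $L$, not a crossing. For $T\subseteq T'$ in $O(L)$ with $T'\setminus T=\{c_1,c_2\}$, $c_1\neq c_2$, each of the resolutions $L_{T\cup\{c_1\}}$ and $L_{T\cup\{c_2\}}$ consists of exactly two circles. Let $B_{T,T'}$ (respectively $W_{T,T'}$) be the set of faces in the component, not containing $p$, of the complement in $S^2$ of the circle of $L_{T\cup\{c_1\}}$ (respectively $L_{T\cup\{c_2\}}$) that does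 not pass through $p$. Then $[B_{T,T'}]\neq0$ and $[W_{T,T'}]\ne0$. Let $CT_i(L,p)$ be the $\mathbb F_L$-vector space with basis $O_i(L)$, and define $\partial_{i}:CT_i(L,p)\to CT_{i+2}(L,p)$ by $$\partial_{i}T=\sum_{T'\in O_{i+2}(L),\ T\subset T'}\left(\frac1{[B_{T,T'}]}+\frac1{[W_{T,T'}]}\right)T'.$$ Then $\partial_{i+2}\circ\partial_i=0$ for all $i$, so that $CT(L,p)=\bigl(\bigoplus_{i\in\mathbb Z}CT_i(L,p),\partial\bigr)$ is a chain complex over $\mathbb F_L$ with differential of degree $2$. Moreover, for any two marked points $p,p'$ on $L$ there is a field automorphism $I$ of $\mathbb F_L$ such that $CT(L,p)\otimes_I\mathbb F_L$ and $CT(L,p')$ are isomorphic as graded chain complexes over $\mathbb F_L$. -/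

import Mathlib

/-- A four-valent graph with vertex set `X`, together with a set `Z` of disjoint circles without
vertices, recorded combinatorially. Each crossing `c : X` has four half-edges
`(c, 0), (c, 1), (c, 2), (c, 3)` in counterclockwise order; `(c, 0)` and `(c, 2)` form the
understrand, `(c, 1)` and `(c, 3)` form the overstrand. The map `opp` sends a half-edge to the
other half of its edge. -/
structure CrossingGraph (X Z : Type*) where
  opp : X × ZMod 4 → X × ZMod 4
  opp_opp : ∀ d, opp (opp d) = d
  opp_ne : ∀ d, opp d ≠ d

/-- The sides of the edges. The side `Sum.inl d` is the left side of the edge of the half-edge `d`,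
seen when one walks along the edge away from the crossing of `d`. A circle without crossings
has two sides. An edge thus has exactly two sides, also when both lie in one face. -/
abbrev EdgeSide (X Z : Type*) := (X × ZMod 4) ⊕ (Z × Bool)

namespace CrossingGraph

variable {X Z : Type*} (G : CrossingGraph X Z)

/-- The other side of the same edge. -/
def flip : EdgeSide X Z → EdgeSide X Z
  | Sum.inl d => Sum.inl (G.opp d)
  | Sum.inr (z, b) => Sum.inr (z, !b)

/-- The next side along the boundary of the face: walk along the edge, keeping the face on the
left, and turn left at the crossing at its end. -/
def next : EdgeSide X Z → EdgeSide X Z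
  | Sum.inl d => Sum.inl ((G.opp d).1, (G.opp d).2 - 1)
  | Sum.inr s => Sum.inr s

/-- Two sides that belong to the same edge, or to two edges that meet at a crossing. -/
inductive Touch : EdgeSide X Z → EdgeSide X Z → Prop
  | edge (s : EdgeSide X Z) : Touch s (G.flip s)
  | vertex (c : X) (i j : ZMod 4) : Touch (Sum.inl (c, i)) (Sum.inl (c, j))

/-- The connected components of the image of the projection. -/
def Component : Type _ := Quot G.Touch

end CrossingGraph

/-- A link diagram on the sphere, up to homeomorphism, with set of crossings `X`, set of
components without crossings `Z` and set of faces `F` (the components of the complement of the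
image of the projection in the sphere). The diagram need not be connected, so a face may
have several boundary walks. The last two fields say that the surface made from the diagram and
its faces is a connected surface and satisfies the Euler formula `V - E + F = 1 + C` of a
graph with `C` components on the sphere; here `V - E = -|X|`, because there are `2 |X|` edges between
crossings, and a circle without crossings counts as one vertex and one edge. -/
structure LinkDiagram (X Z F : Type*) extends CrossingGraph X Z where
  /-- the face to which an edge side belongs -/
  face : EdgeSide X Z → F
  face_next : ∀ s, face (toCrossingGraph.next s) = face s
  face_surjective : Function.Surjective face
  connected : ∀ f g : F, Relation.EqvGen
    (fun f g => ∃ s, f = face s ∧ g = face (toCrossingGraph.flip s)) f g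
  euler : Nat.card F = Nat.card X + Nat.card toCrossingGraph.Component + 1

namespace LinkDiagram

noncomputable section

variable {X Z F : Type*} (L : LinkDiagram X Z F) [DecidableEq X]

/-- The half-edge to which `d` is joined in the resolution `L_S`. A crossing outside `S` gets its
`0`-resolution, which joins the half-edges `0, 1` and `2, 3`; a crossing in `S` gets its
`1`-resolution, which joins `1, 2` and `3, 0`. -/
def smooth (S : Finset X) (d : X × ZMod 4) : X × ZMod 4 :=
  (d.1, if d.1 ∈ S then 3 - d.2 else 1 - d.2)

/-- Two sides that follow each other on a circle of the resolution `L_S`. -/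
inductive Strand (S : Finset X) : EdgeSide X Z → EdgeSide X Z → Prop
  | edge (s : EdgeSide X Z) : Strand S s (L.flip s)
  | arc (d : X × ZMod 4) : Strand S (Sum.inl d) (Sum.inl (smooth S d))

/-- The set of circles of the resolution `L_S`. -/
def Circle (S : Finset X) : Type _ := Quot (L.Strand S)

/-- The circle of `L_S` that runs along the edge with side `s`. -/
def circleOf (S : Finset X) (s : EdgeSide X Z) : L.Circle S := Quot.mk _ s

/-- `S ∈ O(L)`: the resolution `L_S` is a single circle. -/
def IsSingleCircle (S : Finset X) : Prop := Nat.card (L.Circle S) = 1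

/-- Two faces of `L_S` that are joined by a path which avoids the circle `C` of `L_S` and either
passes between the two strands of one resolved crossing (`bridge`) or crosses one edge of a circle
other than `C` (`cross`). The quadrant between the half-edges `i` and `i + 1` of a crossing
lies in the face of the side `(c, i)`, so the `0`-resolution opens a passage between the quadrants
`1` and `3`, the `1`-resolution between the quadrants `0` and `2`. -/
inductive Passage (S : Finset X) (C : L.Circle S) : F → F → Prop
  | bridge (c : X) : Passage S C (L.face (Sum.inl (c, if c ∈ S then 0 else 1)))
      (L.face (Sum.inl (c, if c ∈ S then 2 else 3)))
  | cross (s : EdgeSide X Z) (h : L.circleOf S s ≠ C) :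
      Passage S C (L.face s) (L.face (L.flip s))

/-- The interior of a circle `C` of `L_S` that does not contain the marked point, as a set of faces:
the component of the complement of `C` in the sphere that does not contain the marked point.
The marked point is a non-crossing point of the diagram; it is recorded by (either side of) the
edge on which it lies. -/
def interior (p : EdgeSide X Z) (S : Finset X) (C : L.Circle S) : Set F :=
  {f | ¬ Relation.EqvGen (L.Passage S C) (L.face p) f}

/-- The union of the interiors of the circles of `L_S` other than the marked one. For
`S = T ∪ {c}` with `T ⊆ T'` in `O(L)`, `T' \ T` of cardinality two and `c ∈ T' \ T`, there is
only one such circle, and this is the region cleaved off by changing the resolution at `c`. -/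
def cleaved (p : EdgeSide X Z) (S : Finset X) : Set F :=
  {f | ∃ C : L.Circle S, C ≠ L.circleOf S p ∧ f ∈ L.interior p S C}

/-- The field of fractions of the polynomial ring over `ℤ/2` in the face variables. -/
abbrev FaceField (F : Type*) := FractionRing (MvPolynomial F (ZMod 2))

/-- The formal area of a set of faces: the sum of their variables. -/
def area [Fintype F] (R : Set F) : FaceField F :=
  ∑ f : F, R.indicator (fun f => algebraMap (MvPolynomial F (ZMod 2)) _ (MvPolynomial.X f)) f

/-- The coefficient `⟨T, T'⟩` of the differential. -/
def coeff [Fintype F] (p : EdgeSide X Z) (T T' : Finset X) : FaceField F :=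
  if T ⊆ T' ∧ (T' \ T).card = 2 then ∑ c ∈ T' \ T, 1 / area (L.cleaved p (insert c T)) else 0

/-- The set `O_i(L)` of single circle resolutions of degree `i`. -/
abbrev Gen (i : ℤ) := {T : Finset X // L.IsSingleCircle T ∧ (T.card : ℤ) = i}

variable [Fintype X] [Fintype F]

/-- The component from degree `i` to degree `j` of the linear map
`∂ T = ∑ T', ⟨T, T'⟩ T'`; it vanishes unless `j = i + 2`. -/
def boundary (p : EdgeSide X Z) (i j : ℤ) :
    (L.Gen i →₀ FaceField F) →ₗ[FaceField F] (L.Gen j →₀ FaceField F) :=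
  Finsupp.linearCombination (FaceField F) fun T =>
    Finsupp.equivFunOnFinite.symm fun T' => L.coeff p T.1 T'.1

lemma boundary_eq_zero (p : EdgeSide X Z) (i j : ℤ) (hij : i + 2 ≠ j) :
    L.boundary p i j = 0 := by
  ext T T'
  have h : ¬ (T.1 ⊆ T'.1 ∧ (T'.1 \ T.1).card = 2) := by
    rintro ⟨h1, h2⟩
    have h3 := Finset.card_sdiff_add_card_eq_card h1
    have h4 := T.2.2
    have h5 := T'.2.2
    omega
  simp [boundary, coeff, h]

/-- The spanning tree complex `CT(L, p)`, with a differential of degree `2`, once it is known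
that the composition of two boundary maps is zero. -/
def CT (p : EdgeSide X Z)
    (h : ∀ i j k : ℤ, L.boundary p j k ∘ₗ L.boundary p i j = 0) :
    HomologicalComplex (ModuleCat (FaceField F)) (ComplexShape.up' (2 : ℤ)) where
  X i := ModuleCat.of (FaceField F) (L.Gen i →₀ FaceField F)
  d i j := ModuleCat.ofHom (L.boundary p i j)
  shape i j hij := by
    rw [L.boundary_eq_zero p i j hij]
    rfl
  d_comp_d' i j k _ _ := by
    rw [← ModuleCat.ofHom_comp, h i j k]
    rfl

end

end LinkDiagram

/-! Regions become functions `F → ZMod 2`. The jump of such a function along the bridge of a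
crossing is the sum of its coboundaries at the two ends of a smoothing arc (`jump_eq_cobound`), so a
function without jumps has a coboundary that is constant on each circle. If `L_T` is one circle, the
values at the two faces beside `p` and the jumps therefore determine the function; Euler's formula
makes them independent coordinates. The dual basis vector `e c` is the indicator of the region
cleaved off by changing the resolution at `c` (`IsDual.cleaved_eq`).

The jumps of the `e j` for the opposite resolutions form a symmetric matrix `m` with zero diagonal,
the interlacement matrix of the chords; this comes from the quadratic identity
`sum_jump_mul_jump_compl`. Changing the resolutions of two crossings gives a single circle again
exactly when their entry is `1`. For `T ⊆ U` differing in four crossings, `m` also expresses the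
areas cut from `L_T` through those cut from `L_U` (`area_eq_sum`). The coefficient of `U` in `∂∂T`
is then a sum over pairs which vanishes by the rational identity `sum_inv_combination` in
characteristic two.

To move the marked point, multiples of the checkerboard colouring `β` and of `1 + β` are added to
the functions. These have no jumps in any resolution, so one linear involution transports the dual
bases of all single circle resolutions at once, and it extends to the field automorphism. -/

namespace CrossingGraph

variable {X Z : Type*} (G : CrossingGraph X Z)

@[simp] lemma flip_flip (s : EdgeSide X Z) : G.flip (G.flip s) = s := by
  rcases s with d | ⟨z, b⟩ <;> simp [flip, G.opp_opp]

end CrossingGraph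

namespace LinkDiagram

/-! ### Functions on the faces modulo two: coboundaries and jumps. -/

section Cochains

variable {X Z F : Type*} (L : LinkDiagram X Z F)

/-- Thus the half-edge `i` at `c` separates the quadrants `i` and `i - 1`. -/
lemma face_flip_inl (c : X) (i : ZMod 4) :
    L.face (L.flip (Sum.inl (c, i))) = L.face (Sum.inl (c, i - 1)) := by
  rw [← L.face_next]
  simp [CrossingGraph.flip, CrossingGraph.next, L.opp_opp]

/-- The coboundary of a function on the faces: its change across an edge. -/
def cobound (r : F → ZMod 2) (s : EdgeSide X Z) : ZMod 2 :=
  r (L.face s) + r (L.face (L.flip s))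

lemma cobound_flip (r : F → ZMod 2) (s : EdgeSide X Z) :
    L.cobound r (L.flip s) = L.cobound r s := by
  simp [cobound, add_comm]

lemma cobound_inl (r : F → ZMod 2) (c : X) (i : ZMod 4) :
    L.cobound r (Sum.inl (c, i)) =
      r (L.face (Sum.inl (c, i))) + r (L.face (Sum.inl (c, i - 1))) := by
  rw [cobound, face_flip_inl]

lemma eq_of_cobound_eq_zero {r : F → ZMod 2} (h : ∀ s, L.cobound r s = 0) (f g : F) :
    r f = r g := by
  induction L.connected f g with
  | rel f g h' =>
    obtain ⟨s, rfl, rfl⟩ := h'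
    exact CharTwo.add_eq_zero.1 (h s)
  | refl => rfl
  | symm _ _ _ ih => exact ih.symm
  | trans _ _ _ _ _ ih₁ ih₂ => exact ih₁.trans ih₂

variable [DecidableEq X]

/-- The change of a function on the faces along the bridge of a resolved crossing. -/
def jump (S : Finset X) (c : X) : (F → ZMod 2) →ₗ[ZMod 2] ZMod 2 where
  toFun r := r (L.face (Sum.inl (c, if c ∈ S then 0 else 1))) +
    r (L.face (Sum.inl (c, if c ∈ S then 2 else 3)))
  map_add' r r' := by simp only [Pi.add_apply]; ring
  map_smul' a r := by simp [mul_add]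

lemma jump_apply (S : Finset X) (c : X) (r : F → ZMod 2) :
    L.jump S c r = r (L.face (Sum.inl (c, if c ∈ S then 0 else 1))) +
      r (L.face (Sum.inl (c, if c ∈ S then 2 else 3))) := rfl

lemma jump_congr {S T : Finset X} {c : X} (h : c ∈ S ↔ c ∈ T) : L.jump S c = L.jump T c := by
  simp [jump, h]

/-- `Tᶜ` carries the opposite resolution at every crossing, so each jump of any `S` is a jump of `T`
or of `Tᶜ`. -/
lemma jump_compl_congr [Fintype X] {S T : Finset X} {c : X} (h : ¬ (c ∈ S ↔ c ∈ T)) :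
    L.jump S c = L.jump Tᶜ c :=
  L.jump_congr (by rw [Finset.mem_compl]; tauto)

lemma smooth_smooth (S : Finset X) (d : X × ZMod 4) : smooth S (smooth S d) = d := by
  rcases d with ⟨c, i⟩
  by_cases h : c ∈ S <;> simp [smooth, h]

/-- The quadrant between the two half-edges joined by an arc is counted twice and cancels; what
remains are the two ends of the bridge. -/
lemma jump_eq_cobound (S : Finset X) (c : X) (i : ZMod 4) (r : F → ZMod 2) :
    L.jump S c r =
      L.cobound r (Sum.inl (c, i)) + L.cobound r (Sum.inl (smooth S (c, i))) := by
  have key : ∀ (q : ZMod 4 → ZMod 2) (i : ZMod 4),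
      q 0 + q 2 = q i + q (i - 1) + (q (3 - i) + q (3 - i - 1)) ∧
      q 1 + q 3 = q i + q (i - 1) + (q (1 - i) + q (1 - i - 1)) := by
    intro q i
    have h : ∀ a b c d : ZMod 2, a + c = a + d + (d + c) ∧ a + c = b + a + (c + b) ∧
      a + c = c + b + (b + a) ∧ a + c = d + c + (a + d) := by decide
    obtain ⟨h1, h2, h3, h4⟩ := h (q 0) (q 1) (q 2) (q 3)
    obtain ⟨h1', h2', h3', h4'⟩ := h (q 1) (q 2) (q 3) (q 0)
    fin_cases i
    · exact ⟨h1, h4'⟩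
    · exact ⟨h2, h1'⟩
    · exact ⟨h3, h2'⟩
    · exact ⟨h4, h3'⟩
  have k := key (fun i => r (L.face (Sum.inl (c, i)))) i
  by_cases h : c ∈ S
  · simpa [jump_apply, smooth, h, cobound_inl] using k.1
  · simpa [jump_apply, smooth, h, cobound_inl] using k.2

lemma cobound_smooth {S : Finset X} {r : F → ZMod 2} (d : X × ZMod 4) (h : L.jump S d.1 r = 0) :
    L.cobound r (Sum.inl (smooth S d)) = L.cobound r (Sum.inl d) := by
  rw [L.jump_eq_cobound S d.1 d.2] at h
  exact (CharTwo.add_eq_zero.1 h).symm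

/-- With `q i` the value in the quadrant `i`, the product `(q 0 + q 2) * (q 1 + q 3)` is the sum
over the four half-edges of the product of the values on their two sides. Summed over all crossings,
every edge occurs twice, once for each of its halves. -/
lemma sum_jump_mul_jump_compl [Fintype X] (S : Finset X) (r : F → ZMod 2) :
    ∑ c, L.jump S c r * L.jump Sᶜ c r = 0 := by
  let g : X × ZMod 4 → ZMod 2 := fun d => r (L.face (Sum.inl d)) * r (L.face (Sum.inl (L.opp d)))
  have h1 : ∀ c, L.jump S c r * L.jump Sᶜ c r = ∑ i, g (c, i) := by
    intro c
    have h2 : ∀ i, g (c, i) = r (L.face (Sum.inl (c, i))) * r (L.face (Sum.inl (c, i - 1))) := by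
      intro i
      rw [← face_flip_inl]
      rfl
    have h3 : ∑ i, g (c, i) = g (c, 0) + g (c, 1) + g (c, 2) + g (c, 3) :=
      Fin.sum_univ_four (fun i => g (c, i))
    rw [h3, h2, h2, h2, h2]
    have e0 : (0 : ZMod 4) - 1 = 3 := rfl
    have e1 : (1 : ZMod 4) - 1 = 0 := rfl
    have e2 : (2 : ZMod 4) - 1 = 1 := rfl
    have e3 : (3 : ZMod 4) - 1 = 2 := rfl
    rw [e0, e1, e2, e3]
    by_cases h : c ∈ S <;> simp [jump_apply, h] <;> ring
  rw [Finset.sum_congr rfl fun c _ => h1 c, ← Fintype.sum_prod_type]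
  refine Finset.sum_involution (fun d _ => L.opp d) ?_ (fun d _ _ => L.opp_ne d) (by simp)
    (fun d _ => L.opp_opp d)
  intro d _
  simp only [g, L.opp_opp]
  rw [mul_comm]
  exact CharTwo.add_self_eq_zero _

/-- Polarization of the quadratic identity. -/
lemma sum_jump_mul_jump_compl_add [Fintype X] (S : Finset X) (r r' : F → ZMod 2) :
    ∑ c, (L.jump S c r * L.jump Sᶜ c r' + L.jump S c r' * L.jump Sᶜ c r) = 0 := by
  have h := L.sum_jump_mul_jump_compl S (r + r')
  have h1 := L.sum_jump_mul_jump_compl S r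
  have h2 := L.sum_jump_mul_jump_compl S r'
  have h3 : ∀ c, L.jump S c (r + r') * L.jump Sᶜ c (r + r') = L.jump S c r * L.jump Sᶜ c r +
      L.jump S c r' * L.jump Sᶜ c r' +
      (L.jump S c r * L.jump Sᶜ c r' + L.jump S c r' * L.jump Sᶜ c r) := by
    intro c
    simp only [map_add]
    ring
  rw [Finset.sum_congr rfl fun c _ => h3 c, Finset.sum_add_distrib, Finset.sum_add_distrib,
    h1, h2] at h
  simpa using h

/-- A function on the sides that is constant along the strands descends to the circles. -/
lemma eq_of_circleOf_eq {α : Type*} {S : Finset X} {w : EdgeSide X Z → α}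
    (hf : ∀ s, w (L.flip s) = w s) (ha : ∀ d, w (Sum.inl (smooth S d)) = w (Sum.inl d))
    {s t : EdgeSide X Z} (h : L.circleOf S s = L.circleOf S t) : w s = w t := by
  have hw : ∀ a b, L.Strand S a b → w a = w b := by
    intro a b hab
    cases hab with
    | edge => exact (hf _).symm
    | arc d => exact (ha d).symm
  exact congrArg (Quot.lift w hw) h

end Cochains

/-! ### Coordinates given by a single circle resolution. -/

section SingleCircle

variable {X Z F : Type*} (L : LinkDiagram X Z F) [DecidableEq X] {S T : Finset X}

variable {L} in
lemma IsSingleCircle.circleOf_eq (hT : L.IsSingleCircle T) (s t : EdgeSide X Z) :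
    L.circleOf T s = L.circleOf T t :=
  haveI := (Nat.card_eq_one_iff_unique.1 hT).1
  Subsingleton.elim _ _

variable {L} in
lemma IsSingleCircle.card_component (hT : L.IsSingleCircle T) : Nat.card L.Component = 1 := by
  obtain ⟨h1, ⟨C⟩⟩ := Nat.card_eq_one_iff_unique.1 hT
  obtain ⟨s, rfl⟩ := Quot.exists_rep C
  refine Nat.card_eq_one_iff_unique.2 ⟨⟨fun a b => ?_⟩, ⟨Quot.mk _ s⟩⟩
  obtain ⟨a, rfl⟩ := Quot.exists_rep a
  obtain ⟨b, rfl⟩ := Quot.exists_rep b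
  refine L.eq_of_circleOf_eq (w := fun s => (Quot.mk _ s : L.Component)) (fun s => ?_)
    (fun d => ?_) (hT.circleOf_eq a b)
  · exact (Quot.sound (CrossingGraph.Touch.edge s)).symm
  · exact (Quot.sound (CrossingGraph.Touch.vertex d.1 _ _))

variable {L} in
-- Without jumps the coboundary is constant along the only circle, hence equal to its value `0` at
-- `p`; then `r` is constant.
lemma IsSingleCircle.eq_zero_of_jump (hT : L.IsSingleCircle T) {p : EdgeSide X Z}
    {r : F → ZMod 2} (h0 : r (L.face p) = 0) (h1 : r (L.face (L.flip p)) = 0)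
    (hr : ∀ c, L.jump T c r = 0) : r = 0 := by
  have h : ∀ s, L.cobound r s = 0 := by
    intro s
    rw [L.eq_of_circleOf_eq (w := L.cobound r) (L.cobound_flip r)
      (fun d => L.cobound_smooth d (hr _)) (hT.circleOf_eq s p), cobound, h0, h1, add_zero]
  funext f
  rw [L.eq_of_cobound_eq_zero h f (L.face p), h0, Pi.zero_apply]

variable [Fintype X] [Fintype F]

variable {L} in
/-- The bridges of a single circle resolution form two trees: a function on the faces is
given by its values at the two sides of a point of the circle and its jumps along the bridges. -/
lemma IsSingleCircle.exists_jump_eq (hT : L.IsSingleCircle T) (p : EdgeSide X Z)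
    (a b : ZMod 2) (t : X → ZMod 2) :
    ∃ r : F → ZMod 2, r (L.face p) = a ∧ r (L.face (L.flip p)) = b ∧ ∀ c, L.jump T c r = t c := by
  let Φ : (F → ZMod 2) →ₗ[ZMod 2] ZMod 2 × ZMod 2 × (X → ZMod 2) :=
    (LinearMap.proj (R := ZMod 2) (φ := fun _ : F => ZMod 2) (L.face p)).prod
      ((LinearMap.proj (R := ZMod 2) (φ := fun _ : F => ZMod 2) (L.face (L.flip p))).prod (LinearMap.pi (L.jump T)))
  have hinj : Function.Injective Φ := by
    rw [← LinearMap.ker_eq_bot, LinearMap.ker_eq_bot']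
    intro r hr
    simp only [Φ, LinearMap.prod_apply, Function.prod_apply, Prod.mk_eq_zero] at hr
    exact hT.eq_zero_of_jump hr.1 hr.2.1 (fun c => congrFun hr.2.2 c)
  -- Euler's formula with one component makes both sides of `Φ` equidimensional, so injectivity
  -- gives surjectivity.
  have hcard : Fintype.card F = Fintype.card X + 2 := by
    have := L.euler
    rw [hT.card_component] at this
    simpa using this
  have hdim : Module.finrank (ZMod 2) (F → ZMod 2) =
      Module.finrank (ZMod 2) (ZMod 2 × ZMod 2 × (X → ZMod 2)) := by
    simp [hcard]
    omega
  obtain ⟨r, hr⟩ :=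
    (LinearMap.injective_iff_surjective_of_finrank_eq_finrank hdim).1 hinj (a, b, t)
  simp only [Φ, LinearMap.prod_apply, Function.prod_apply, Prod.mk.injEq] at hr
  exact ⟨r, hr.1, hr.2.1, fun c => congrFun hr.2.2 c⟩

variable {L} in
/-- On the sphere every cycle modulo two bounds. -/
lemma IsSingleCircle.exists_cobound_eq (hT : L.IsSingleCircle T) (p : EdgeSide X Z)
    {z : EdgeSide X Z → ZMod 2} (hf : ∀ s, z (L.flip s) = z s)
    (hz : ∀ c, z (Sum.inl (c, 0)) + z (Sum.inl (c, 1)) + z (Sum.inl (c, 2)) +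
      z (Sum.inl (c, 3)) = 0) :
    ∃ r : F → ZMod 2, r (L.face p) = 0 ∧ ∀ s, L.cobound r s = z s := by
  -- The jump is prescribed by the arc at the half-edge `0`; the cycle condition says that the other
  -- arc at `c` prescribes the same jump.
  obtain ⟨r, h0, h1, hr⟩ := hT.exists_jump_eq p 0 (z p)
    (fun c => z (Sum.inl (c, 0)) + z (Sum.inl (smooth T (c, 0))))
  have hz' : ∀ d : X × ZMod 4, z (Sum.inl d) + z (Sum.inl (smooth T d)) = L.jump T d.1 r := by
    rintro ⟨c, i⟩
    have key : ∀ (q : ZMod 4 → ZMod 2), q 0 + q 1 + q 2 + q 3 = 0 → ∀ i : ZMod 4,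
        q i + q (3 - i) = q 0 + q 3 ∧ q i + q (1 - i) = q 0 + q 1 := by
      intro q hq i
      have h : ∀ a b c d : ZMod 2, a + b + c + d = 0 →
          b + c = a + d ∧ c + b = a + d ∧ c + d = a + b ∧ d + c = a + b := by decide
      obtain ⟨h1, h2, h3, h4⟩ := h _ _ _ _ hq
      fin_cases i
      · exact ⟨rfl, rfl⟩
      · exact ⟨h1, add_comm _ _⟩
      · exact ⟨h2, h3⟩
      · exact ⟨add_comm _ _, h4⟩
    have k := key (fun i => z (Sum.inl (c, i))) (hz c) i
    rw [hr]
    by_cases h : c ∈ T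
    · simpa [smooth, h] using k.1
    · simpa [smooth, h] using k.2
  refine ⟨r, h0, fun s => ?_⟩
  -- The difference of the coboundary and `z` is constant along the single circle and zero at `p`.
  have h := L.eq_of_circleOf_eq (w := fun s => L.cobound r s + z s) (S := T)
    (fun s => by rw [cobound_flip, hf]) (fun d => ?_) (hT.circleOf_eq s p)
  · simp only [cobound, h0, h1, zero_add] at h
    rw [CharTwo.add_self_eq_zero] at h
    exact CharTwo.add_eq_zero.1 h
  · have h2 := hz' d
    rw [L.jump_eq_cobound T d.1 d.2] at h2
    have h3 : ∀ a b c d : ZMod 2, a + b = c + d → d + b = c + a := by decide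
    exact h3 _ _ _ _ h2

/-- The function which changes exactly across one given circle of a resolution. -/
lemma exists_cobound_circle (hT : L.IsSingleCircle T) {p : EdgeSide X Z} {C : L.Circle S}
    (hC : C ≠ L.circleOf S p) :
    ∃ r : F → ZMod 2, r (L.face p) = 0 ∧ r (L.face (L.flip p)) = 0 ∧ (∀ c, L.jump S c r = 0) ∧
      ∀ s, L.cobound r s = 1 ↔ L.circleOf S s = C := by
  classical
  -- `C` passes a crossing along whole arcs, so it uses an even number of half-edges there: its
  -- indicator is a cycle.
  let z : EdgeSide X Z → ZMod 2 := fun s => if L.circleOf S s = C then 1 else 0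
  have hs : ∀ d, z (Sum.inl (smooth S d)) = z (Sum.inl d) := by
    intro d
    have : L.circleOf S (Sum.inl (smooth S d)) = L.circleOf S (Sum.inl d) :=
      (Quot.sound (Strand.arc d)).symm
    simp only [z, this]
  have hf : ∀ s, z (L.flip s) = z s := by
    intro s
    have : L.circleOf S (L.flip s) = L.circleOf S s := (Quot.sound (Strand.edge s)).symm
    simp only [z, this]
  have hz : ∀ c, z (Sum.inl (c, 0)) + z (Sum.inl (c, 1)) + z (Sum.inl (c, 2)) +
      z (Sum.inl (c, 3)) = 0 := by
    intro c
    have h2 : ∀ a b : ZMod 2, a + a + b + b = 0 ∧ a + b + b + a = 0 := by decide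
    by_cases h : c ∈ S
    · have e0 : z (Sum.inl (c, 3)) = z (Sum.inl (c, 0)) := by
        simpa [smooth, h] using hs (c, 0)
      have e1 : z (Sum.inl (c, 2)) = z (Sum.inl (c, 1)) := by
        have := hs (c, 1)
        simp only [smooth, h, if_true] at this
        exact this
      rw [e0, e1]
      exact (h2 _ _).2
    · have e0 : z (Sum.inl (c, 1)) = z (Sum.inl (c, 0)) := by
        simpa [smooth, h] using hs (c, 0)
      have e1 : z (Sum.inl (c, 3)) = z (Sum.inl (c, 2)) := by
        have := hs (c, 2)
        simp only [smooth, h, if_false] at this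
        exact this
      rw [e0, e1]
      exact (h2 _ _).1
  obtain ⟨r, h0, hr⟩ := hT.exists_cobound_eq p hf hz
  refine ⟨r, h0, ?_, fun c => ?_, fun s => ?_⟩
  · simpa [cobound, h0, z, hC.symm] using hr p
  · rw [L.jump_eq_cobound S c 0, hr, hr, hs, CharTwo.add_self_eq_zero]
  · rw [hr]
    simp [z]

/-- Converse of `IsSingleCircle.eq_zero_of_jump`: a circle away from `p` would give a nonzero
function without jumps. -/
lemma isSingleCircle_of_jump (hT : L.IsSingleCircle T) (p : EdgeSide X Z)
    (h : ∀ r : F → ZMod 2, r (L.face p) = 0 → r (L.face (L.flip p)) = 0 →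
      (∀ c, L.jump S c r = 0) → r = 0) : L.IsSingleCircle S := by
  have key : ∀ C : L.Circle S, C = L.circleOf S p := by
    intro C
    by_contra hC
    obtain ⟨r, h0, h4, h1, h2⟩ := L.exists_cobound_circle hT hC
    obtain ⟨s, rfl⟩ := Quot.exists_rep C
    have h5 := (h2 s).2 rfl
    rw [h r h0 h4 h1] at h5
    simp [cobound] at h5
  exact Nat.card_eq_one_iff_unique.2
    ⟨⟨fun a b => (key a).trans (key b).symm⟩, ⟨L.circleOf S p⟩⟩

end SingleCircle

end LinkDiagram

namespace LinkDiagram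

/-! ### The interior of a circle as a level set. -/

section Cleaved

variable {X Z F : Type*} (L : LinkDiagram X Z F) [DecidableEq X] {S T : Finset X}

/-- Both half-edges of an arc point away from the crossing, so the left side of one continues as the
right side of the other, either within one quadrant or across the bridge. -/
lemma passage_bridge (C : L.Circle S) (c : X) (i : ZMod 4) :
    Relation.EqvGen (L.Passage S C) (L.face (Sum.inl (c, i)))
      (L.face (L.flip (Sum.inl (smooth S (c, i))))) := by
  have h := Relation.EqvGen.rel _ _ (Passage.bridge (L := L) (S := S) (C := C) c)
  by_cases hc : c ∈ S
  · simp only [hc, if_true] at h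
    simp only [smooth, hc, if_true, face_flip_inl]
    fin_cases i
    · exact h
    · exact Relation.EqvGen.refl _
    · exact h.symm
    · exact Relation.EqvGen.refl _
  · simp only [hc, if_false] at h
    simp only [smooth, hc, if_false, face_flip_inl]
    fin_cases i
    · exact Relation.EqvGen.refl _
    · exact h
    · exact Relation.EqvGen.refl _
    · exact h.symm

/-- All edges of a circle have the same two sides, up to passages that avoid the circle. -/
lemma passage_sides {C : L.Circle S} {s t : EdgeSide X Z}
    (h : L.circleOf S s = L.circleOf S t) :
    (Relation.EqvGen (L.Passage S C) (L.face s) (L.face t) ∧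
      Relation.EqvGen (L.Passage S C) (L.face (L.flip s)) (L.face (L.flip t))) ∨
    (Relation.EqvGen (L.Passage S C) (L.face s) (L.face (L.flip t)) ∧
      Relation.EqvGen (L.Passage S C) (L.face (L.flip s)) (L.face t)) := by
  have key := L.eq_of_circleOf_eq
    (w := fun s => s(Quot.mk (L.Passage S C) (L.face s), Quot.mk _ (L.face (L.flip s))))
    (fun s => by simp [Sym2.eq_swap]) (fun d => ?_) h
  · rw [Sym2.eq_iff] at key
    simpa only [Quot.eq] using key
  · have h1 := Quot.eqvGen_sound (L.passage_bridge C d.1 d.2)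
    have h2 := Quot.eqvGen_sound (L.passage_bridge C d.1 (smooth S d).2)
    have h3 : smooth S (d.1, (smooth S d).2) = d := smooth_smooth S d
    rw [h3] at h2
    rw [Sym2.eq_iff]
    exact Or.inr ⟨h2, h1.symm⟩

/-- The complement of `C` has at most two components: crossing an edge of `C` leads from one side of
`C` to the other, and crossing any other edge is a passage. -/
lemma passage_or (C : L.Circle S) {s : EdgeSide X Z} (hs : L.circleOf S s = C) (f : F) :
    Relation.EqvGen (L.Passage S C) (L.face s) f ∨
      Relation.EqvGen (L.Passage S C) (L.face (L.flip s)) f := by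
  have key : ∀ t, (Relation.EqvGen (L.Passage S C) (L.face s) (L.face t) ∨
      Relation.EqvGen (L.Passage S C) (L.face (L.flip s)) (L.face t)) →
      (Relation.EqvGen (L.Passage S C) (L.face s) (L.face (L.flip t)) ∨
      Relation.EqvGen (L.Passage S C) (L.face (L.flip s)) (L.face (L.flip t))) := by
    intro t ht
    by_cases hC : L.circleOf S t = C
    · rcases L.passage_sides (C := C) (hs.trans hC.symm) with h | h
      · exact Or.inr h.2
      · exact Or.inl h.1
    · have h := Relation.EqvGen.rel _ _ (Passage.cross (L := L) t hC)
      exact ht.imp (fun h' => h'.trans _ _ _ h) (fun h' => h'.trans _ _ _ h)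
  have h2 : ∀ f g, Relation.EqvGen (fun f g => ∃ s, f = L.face s ∧ g = L.face (L.flip s)) f g →
      ((Relation.EqvGen (L.Passage S C) (L.face s) f ∨
        Relation.EqvGen (L.Passage S C) (L.face (L.flip s)) f) ↔
      (Relation.EqvGen (L.Passage S C) (L.face s) g ∨
        Relation.EqvGen (L.Passage S C) (L.face (L.flip s)) g)) := by
    intro f g h
    induction h with
    | rel f g h =>
      obtain ⟨t, rfl, rfl⟩ := h
      refine ⟨key t, fun h => ?_⟩
      simpa using key (L.flip t) h
    | refl => exact Iff.rfl
    | symm _ _ _ ih => exact ih.symm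
    | trans _ _ _ _ _ ih₁ ih₂ => exact ih₁.trans ih₂
  exact (h2 _ _ (L.connected (L.face s) f)).1 (Or.inl (Relation.EqvGen.refl _))

lemma eq_of_passage {C : L.Circle S} {r : F → ZMod 2} (h0 : ∀ c, L.jump S c r = 0)
    (h1 : ∀ s, L.cobound r s = 1 ↔ L.circleOf S s = C) {f g : F}
    (h : Relation.EqvGen (L.Passage S C) f g) : r f = r g := by
  induction h with
  | rel f g h =>
    cases h with
    | bridge c => exact CharTwo.add_eq_zero.1 (h0 c)
    | cross s hs =>
      have h2 : L.cobound r s ≠ 1 := fun h => hs ((h1 s).1 h)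
      have : ∀ a b : ZMod 2, a + b ≠ 1 → a = b := by decide
      exact this _ _ h2
  | refl => rfl
  | symm _ _ _ ih => exact ih.symm
  | trans _ _ _ _ _ ih₁ ih₂ => exact ih₁.trans ih₂

/-- `r` is constant on passage classes, there are at most two of them, and `r` differs on the two
sides of `C`; so its level sets are the classes. -/
lemma interior_eq {p : EdgeSide X Z} {C : L.Circle S} {r : F → ZMod 2}
    (h0 : ∀ c, L.jump S c r = 0) (h1 : ∀ s, L.cobound r s = 1 ↔ L.circleOf S s = C)
    (hp : r (L.face p) = 0) : L.interior p S C = {f | r f = 1} := by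
  ext f
  simp only [interior, Set.mem_ofPred_eq]
  obtain ⟨s, hs⟩ := Quot.exists_rep C
  have h2 : ∀ a b c d : ZMod 2, a = 0 → b ≠ 1 → c + d = 1 → a = c → b = d → False := by decide
  constructor
  · intro h
    by_contra hf
    have hcs := (h1 s).2 hs
    rcases L.passage_or C hs (L.face p) with hp' | hp' <;> rcases L.passage_or C hs f with hf' | hf'
    · exact h (hp'.symm.trans _ _ _ hf')
    · exact h2 _ _ _ _ hp hf hcs (L.eq_of_passage h0 h1 hp').symm (L.eq_of_passage h0 h1 hf').symm
    · rw [cobound, add_comm] at hcs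
      exact h2 _ _ _ _ hp hf hcs (L.eq_of_passage h0 h1 hp').symm (L.eq_of_passage h0 h1 hf').symm
    · exact h (hp'.symm.trans _ _ _ hf')
  · intro h h'
    rw [← L.eq_of_passage h0 h1 h', hp] at h
    exact zero_ne_one h

end Cleaved

/-! ### The dual basis and the interlacement matrix. -/

section Dual

variable {X Z F : Type*} {L : LinkDiagram X Z F} [DecidableEq X] {S T : Finset X}

/-- The members of the basis of the functions vanishing at the faces of `p` which is dual to the
jumps along the bridges of `L_T`. -/
structure IsDual (L : LinkDiagram X Z F) (p : EdgeSide X Z) (T : Finset X) (c : X)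
    (e : F → ZMod 2) : Prop where
  face_eq : e (L.face p) = 0
  face_flip_eq : e (L.face (L.flip p)) = 0
  jump_eq : ∀ d, L.jump T d e = if d = c then 1 else 0

lemma IsDual.ne_zero {p : EdgeSide X Z} {c : X} {e : F → ZMod 2}
    (he : L.IsDual p T c e) : e ≠ 0 := by
  rintro rfl
  simpa using he.jump_eq c

/-- The coordinates of a function in the dual basis. -/
lemma IsSingleCircle.eq_sum_of_isDual (hT : L.IsSingleCircle T) {p : EdgeSide X Z}
    {A : Finset X} {e : X → F → ZMod 2} (he : ∀ c ∈ A, L.IsDual p T c (e c)) {r : F → ZMod 2}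
    (h0 : r (L.face p) = 0) (h1 : r (L.face (L.flip p)) = 0) (h2 : ∀ c ∉ A, L.jump T c r = 0) :
    r = ∑ c ∈ A, L.jump T c r • e c := by
  rw [← sub_eq_zero]
  refine hT.eq_zero_of_jump (p := p) ?_ ?_ fun d => ?_
  · simp only [Pi.sub_apply, h0, Finset.sum_apply, Pi.smul_apply, zero_sub, neg_eq_zero]
    exact Finset.sum_eq_zero fun c hc => by simp [(he c hc).face_eq]
  · simp only [Pi.sub_apply, h1, Finset.sum_apply, Pi.smul_apply, zero_sub, neg_eq_zero]
    exact Finset.sum_eq_zero fun c hc => by simp [(he c hc).face_flip_eq]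
  · have h3 : ∑ c ∈ A, L.jump T d (L.jump T c r • e c) =
        ∑ c ∈ A, if d = c then L.jump T c r else 0 :=
      Finset.sum_congr rfl fun c hc => by simp [(he c hc).jump_eq]
    rw [map_sub, map_sum, h3, Finset.sum_ite_eq]
    split_ifs with h
    · exact sub_self _
    · rw [h2 d h, sub_zero]

variable [Fintype X]

namespace IsDual

variable {p : EdgeSide X Z} {c : X} {e : F → ZMod 2}

/-- In the polarized identity for `e` and `e'` the jumps in `L_T` are Kronecker deltas, so only two
terms survive. -/
lemma jump_compl_symm {c' : X} {e' : F → ZMod 2} (he : L.IsDual p T c e)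
    (he' : L.IsDual p T c' e') : L.jump Tᶜ c e' = L.jump Tᶜ c' e := by
  have h := L.sum_jump_mul_jump_compl_add T e e'
  simp only [he.jump_eq, he'.jump_eq, ite_mul, one_mul, zero_mul, Finset.sum_add_distrib,
    Finset.sum_ite_eq', Finset.mem_univ, if_true] at h
  exact CharTwo.add_eq_zero.1 h

lemma jump_compl_self (he : L.IsDual p T c e) : L.jump Tᶜ c e = 0 := by
  have h := L.sum_jump_mul_jump_compl T e
  simpa [he.jump_eq] using h

/-- Changing the resolution at `c` removes the only jump of `e`, because the diagonal of the
interlacement matrix vanishes. -/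
lemma jump_eq_zero (he : L.IsDual p T c e) (hS : ∀ d, (d ∈ S ↔ d ∈ T) ↔ d ≠ c) (d : X) :
    L.jump S d e = 0 := by
  by_cases hd : d = c
  · subst hd
    rw [L.jump_compl_congr (fun h => (hS d).1 h rfl), he.jump_compl_self]
  · rw [L.jump_congr ((hS d).2 hd), he.jump_eq, if_neg hd]

lemma exists_circle_ne (he : L.IsDual p T c e) (hS : ∀ d, (d ∈ S ↔ d ∈ T) ↔ d ≠ c) :
    ∃ C : L.Circle S, C ≠ L.circleOf S p := by
  by_contra! h
  have hS' : L.IsSingleCircle S := Nat.card_eq_one_iff_unique.2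
    ⟨⟨fun a b => (h a).trans (h b).symm⟩, ⟨L.circleOf S p⟩⟩
  exact he.ne_zero (hS'.eq_zero_of_jump he.face_eq he.face_flip_eq (he.jump_eq_zero hS))

variable [Fintype F]

/-- The function that changes exactly across `C` can jump in `L_T` only at `c`, so it is a multiple
of `e`, and it is not zero. In particular, there is only one such `C`. -/
lemma cobound_eq_one_iff (he : L.IsDual p T c e) (hT : L.IsSingleCircle T)
    (hS : ∀ d, (d ∈ S ↔ d ∈ T) ↔ d ≠ c) {C : L.Circle S} (hC : C ≠ L.circleOf S p)
    (s : EdgeSide X Z) : L.cobound e s = 1 ↔ L.circleOf S s = C := by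
  obtain ⟨r, h0, h1, h2, h3⟩ := L.exists_cobound_circle hT hC
  suffices r = e by rw [← this, h3]
  have h4 : ∀ d, d ≠ c → L.jump T d r = 0 := fun d hd => by
    rw [← L.jump_congr ((hS d).2 hd), h2]
  have h5 : L.jump T c r = 1 := by
    by_contra h
    have h6 : ∀ a : ZMod 2, a ≠ 1 → a = 0 := by decide
    have h7 : r = 0 := by
      refine hT.eq_zero_of_jump h0 h1 fun d => ?_
      by_cases hd : d = c
      · rw [hd]
        exact h6 _ h
      · exact h4 d hd
    obtain ⟨t, rfl⟩ := Quot.exists_rep C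
    have h8 := (h3 t).2 rfl
    simp [h7, cobound] at h8
  rw [← sub_eq_zero]
  refine hT.eq_zero_of_jump (p := p) (by simp [h0, he.face_eq]) (by simp [h1, he.face_flip_eq])
    fun d => ?_
  by_cases hd : d = c
  · simp [hd, h5, he.jump_eq]
  · simp [h4 d hd, he.jump_eq, hd]

lemma cleaved_eq (he : L.IsDual p T c e) (hT : L.IsSingleCircle T)
    (hS : ∀ d, (d ∈ S ↔ d ∈ T) ↔ d ≠ c) : L.cleaved p S = {f | e f = 1} := by
  obtain ⟨C, hC⟩ := he.exists_circle_ne hS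
  have h : ∀ C : L.Circle S, C ≠ L.circleOf S p → L.interior p S C = {f | e f = 1} := fun C hC =>
    L.interior_eq (he.jump_eq_zero hS) (he.cobound_eq_one_iff hT hS hC) he.face_eq
  ext f
  refine ⟨?_, fun hf => ⟨C, hC, by rwa [h C hC]⟩⟩
  rintro ⟨C', hC', hf⟩
  rwa [h C' hC'] at hf

lemma card_circle_eq_two (he : L.IsDual p T c e) (hT : L.IsSingleCircle T)
    (hS : ∀ d, (d ∈ S ↔ d ∈ T) ↔ d ≠ c) : Nat.card (L.Circle S) = 2 := by
  obtain ⟨C, hC⟩ := he.exists_circle_ne hS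
  refine Nat.card_eq_two_iff.2 ⟨C, L.circleOf S p, hC, Set.eq_univ_of_forall fun C' => ?_⟩
  by_cases hC' : C' = L.circleOf S p
  · exact Or.inr hC'
  · obtain ⟨s, hs⟩ := Quot.exists_rep C'
    have h1 := (he.cobound_eq_one_iff hT hS hC' s).2 hs
    exact Or.inl (hs.symm.trans ((he.cobound_eq_one_iff hT hS hC s).1 h1))

end IsDual

variable [Fintype F]

lemma IsSingleCircle.exists_isDual (hT : L.IsSingleCircle T) (p : EdgeSide X Z) (c : X) :
    ∃ e, L.IsDual p T c e := by
  obtain ⟨e, h0, h1, h2⟩ := hT.exists_jump_eq p 0 0 (fun d => if d = c then 1 else 0)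
  exact ⟨e, h0, h1, h2⟩

/-- Changing the resolutions of two crossings gives again a single circle if and only if the
chords of the two crossings interlace. -/
lemma IsSingleCircle.isSingleCircle_iff (hT : L.IsSingleCircle T) {p : EdgeSide X Z} {a b : X}
    (hab : a ≠ b) {e : F → ZMod 2} (he : L.IsDual p T b e)
    (hS : ∀ d, (d ∈ S ↔ d ∈ T) ↔ (d ≠ a ∧ d ≠ b)) :
    L.IsSingleCircle S ↔ L.jump Tᶜ a e = 1 := by
  obtain ⟨e', he'⟩ := hT.exists_isDual p a
  have ha : L.jump S a = L.jump Tᶜ a := L.jump_compl_congr fun h => ((hS a).1 h).1 rfl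
  have hb : L.jump S b = L.jump Tᶜ b := L.jump_compl_congr fun h => ((hS b).1 h).2 rfl
  have hd : ∀ d, d ≠ a → d ≠ b → L.jump S d = L.jump T d := fun d h h' =>
    L.jump_congr ((hS d).2 ⟨h, h'⟩)
  constructor
  · intro h
    by_contra h1
    have h6 : ∀ a : ZMod 2, a ≠ 1 → a = 0 := by decide
    -- If the chords do not interlace, `e` has no jump in `L_S` either.
    refine he.ne_zero (h.eq_zero_of_jump he.face_eq he.face_flip_eq fun d => ?_)
    by_cases hda : d = a
    · rw [hda, ha]
      exact h6 _ h1
    · by_cases hdb : d = b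
      · rw [hdb, hb, he.jump_compl_self]
      · rw [hd d hda hdb, he.jump_eq, if_neg hdb]
  · intro h
    refine L.isSingleCircle_of_jump hT p fun r h0 h1 h2 => ?_
    -- `r` lies in the span of `e'` and `e`. As the diagonal entries vanish and the others are `1`,
    -- its jump in `L_S` at `a` is the coefficient of `e`, and at `b` that of `e'`.
    have h3 : r = ∑ c ∈ {a, b}, L.jump T c r • (if c = a then e' else e) := by
      refine hT.eq_sum_of_isDual (p := p) (fun c hc => ?_) h0 h1 fun c hc => ?_
      · rw [Finset.mem_insert, Finset.mem_singleton] at hc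
        rcases hc with rfl | rfl
        · simpa using he'
        · simpa [hab.symm] using he
      · rw [Finset.mem_insert, Finset.mem_singleton, not_or] at hc
        rw [← hd c hc.1 hc.2, h2]
    rw [Finset.sum_pair hab, if_pos rfl, if_neg hab.symm] at h3
    have ka := h2 a
    have kb := h2 b
    rw [ha, h3, map_add, map_smul, map_smul, he'.jump_compl_self, h] at ka
    rw [hb, h3, map_add, map_smul, map_smul, he.jump_compl_self, he.jump_compl_symm he', h] at kb
    simp only [smul_eq_mul, mul_zero, mul_one, zero_add, add_zero] at ka kb
    rw [h3, ka, kb]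
    simp

end Dual

end LinkDiagram

/-! ### The rational identity behind `∂∂ = 0`. -/

section FieldIdentity

variable {K : Type*} [Field K] [CharP K 2]

/-- In characteristic two the left bracket is `m (1/z + 1/w) + n (1/y + 1/w) + o (1/y + 1/z)`, so
the left side collects the terms of `∂∂` that contain `1 / x`. -/
lemma inv_combination_row {m n o x y z w : K} (hm : m = 0 ∨ m = 1) (hn : n = 0 ∨ n = 1)
    (ho : o = 0 ∨ o = 1) (hy : y ≠ 0) (hz : z ≠ 0) (hw : w ≠ 0) (hx : x ≠ 0)
    (h : x = m * y + n * z + o * w) :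
    1 / x * ((m + n + o) * (1 / y + 1 / z + 1 / w) + m * (1 / y) + n * (1 / z) + o * (1 / w)) =
      (1 + o) * (1 / y * (1 / z)) + (1 + n) * (1 / y * (1 / w)) + (1 + m) * (1 / z * (1 / w)) := by
  have h2 : (2 : K) = 0 := CharTwo.two_eq_zero
  rcases hm with rfl | rfl <;> rcases hn with rfl | rfl <;> rcases ho with rfl | rfl
  · simp at h
    exact absurd h hx
  all_goals
    simp only [zero_mul, one_mul, zero_add, add_zero] at h
    subst h
    field_simp
    rw [← sub_eq_zero]
    ring_nf
    try simp only [h2, mul_zero, add_zero, neg_zero, sub_zero]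

/-- The sum of the four row identities: on the right each product of two inverses, such as `1 / b' *
(1 / c')`, occurs in two rows with the same coefficient, here `1 + ad`, and cancels. -/
lemma sum_inv_combination {a b c d a' b' c' d' ab ac ad bc bd cd : K}
    (hab : ab = 0 ∨ ab = 1) (hac : ac = 0 ∨ ac = 1) (had : ad = 0 ∨ ad = 1)
    (hbc : bc = 0 ∨ bc = 1) (hbd : bd = 0 ∨ bd = 1) (hcd : cd = 0 ∨ cd = 1)
    (ha : a ≠ 0) (hb : b ≠ 0) (hc : c ≠ 0) (hd : d ≠ 0)
    (ha' : a' ≠ 0) (hb' : b' ≠ 0) (hc' : c' ≠ 0) (hd' : d' ≠ 0)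
    (h1 : a = ab * b' + ac * c' + ad * d') (h2 : b = ab * a' + bc * c' + bd * d')
    (h3 : c = ac * a' + bc * b' + cd * d') (h4 : d = ad * a' + bd * b' + cd * c') :
    ab * ((1 / a + 1 / b) * (1 / c' + 1 / d')) + ac * ((1 / a + 1 / c) * (1 / b' + 1 / d')) +
      ad * ((1 / a + 1 / d) * (1 / b' + 1 / c')) + bc * ((1 / b + 1 / c) * (1 / a' + 1 / d')) +
      bd * ((1 / b + 1 / d) * (1 / a' + 1 / c')) + cd * ((1 / c + 1 / d) * (1 / a' + 1 / b')) =
      0 := by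
  have k1 := inv_combination_row hab hac had hb' hc' hd' ha h1
  have k2 := inv_combination_row hab hbc hbd ha' hc' hd' hb h2
  have k3 := inv_combination_row hac hbc hcd ha' hb' hd' hc h3
  have k4 := inv_combination_row had hbd hcd ha' hb' hc' hd h4
  have h2 : (2 : K) = 0 := CharTwo.two_eq_zero
  generalize 1 / a = a, 1 / b = b, 1 / c = c, 1 / d = d, 1 / a' = a', 1 / b' = b', 1 / c' = c',
    1 / d' = d' at *
  rw [← sub_eq_zero] at k1 k2 k3 k4
  have key := congrArg₂ (· + ·) (congrArg₂ (· + ·) k1 k2) (congrArg₂ (· + ·) k3 k4)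
  simp only [add_zero] at key
  rw [← key, ← sub_eq_zero]
  ring_nf
  simp only [h2, mul_zero, add_zero, neg_zero, sub_zero]

end FieldIdentity

lemma Finset.sum_powersetCard_two {α M : Type*} [DecidableEq α] [AddCommMonoid M] {a b c d : α}
    (hab : a ≠ b) (hac : a ≠ c) (had : a ≠ d) (hbc : b ≠ c) (hbd : b ≠ d) (hcd : c ≠ d)
    (g : Finset α → M) :
    ∑ B ∈ ({a, b, c, d} : Finset α).powersetCard 2, g B =
      g {a, b} + g {a, c} + g {a, d} + g {b, c} + g {b, d} + g {c, d} := by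
  have h : ({a, b, c, d} : Finset α).powersetCard 2 =
      {{a, b}, {a, c}, {a, d}, {b, c}, {b, d}, {c, d}} := by
    rw [Finset.powersetCard_succ_insert (by simp [*]), Finset.powersetCard_succ_insert (by simp [*]),
      Finset.powersetCard_succ_insert (by simp [*])]
    ext B
    -- The expansion leaves over the two-element subsets of `{d}`, of which there are none.
    have hB : ¬ ((B = ∅ ∨ B = {d}) ∧ B.card = 2) := by
      rintro ⟨rfl | rfl, h⟩ <;> simp at h
    simp [Finset.powersetCard_one]
    tauto
  have key : ∀ {i j k l : α}, i ≠ k → i ≠ l → ({i, j} : Finset α) ≠ {k, l} := by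
    intro i j k l h1 h2 h
    have : i ∈ ({k, l} : Finset α) := h ▸ Finset.mem_insert_self _ _
    simp [h1, h2] at this
  have key' : ∀ {i j k l : α}, j ≠ k → j ≠ l → ({i, j} : Finset α) ≠ {k, l} := by
    intro i j k l h1 h2
    rw [Finset.pair_comm]
    exact key h1 h2
  rw [h, Finset.sum_insert, Finset.sum_insert, Finset.sum_insert, Finset.sum_insert,
    Finset.sum_insert, Finset.sum_singleton]
  · simp only [add_assoc]
  all_goals
    simp only [Finset.mem_insert, Finset.mem_singleton, not_or]
    grind

namespace LinkDiagram

/-! ### Areas as linear forms. -/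

section Area

variable {F : Type*} [Fintype F]

/-- The linear form with given coefficients. -/
noncomputable def linForm : (F → ZMod 2) →ₗ[ZMod 2] MvPolynomial F (ZMod 2) :=
  Fintype.linearCombination (ZMod 2) MvPolynomial.X

lemma linForm_injective : Function.Injective (linForm (F := F)) := by
  classical
  rw [← LinearMap.ker_eq_bot, LinearMap.ker_eq_bot']
  intro r hr
  funext f
  have h := congrArg (MvPolynomial.coeff (Finsupp.single f 1)) hr
  simpa [linForm, Fintype.linearCombination_apply, MvPolynomial.coeff_sum,
    MvPolynomial.coeff_X, Finsupp.single_left_inj] using h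

lemma area_eq (r : F → ZMod 2) :
    area {f | r f = 1} = algebraMap _ (FaceField F) (linForm r) := by
  have h : ∀ a : ZMod 2, a ≠ 1 → a = 0 := by decide
  rw [area, linForm, Fintype.linearCombination_apply, map_sum]
  refine Finset.sum_congr rfl fun f _ => ?_
  by_cases hf : r f = 1
  · simp [hf]
  · simp [h _ hf]

end Area

end LinkDiagram

namespace LinkDiagram

/-! ### The square of the differential. -/

section Boundary

variable {X Z F : Type*} {L : LinkDiagram X Z F} [DecidableEq X] [Fintype F]
  {S T U : Finset X} {p : EdgeSide X Z}

lemma IsDual.linForm_ne_zero {c : X} {e : F → ZMod 2} (he : L.IsDual p T c e) :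
    algebraMap _ (FaceField F) (linForm e) ≠ 0 := by
  rw [Ne, FaithfulSMul.algebraMap_eq_zero_iff, map_eq_zero_iff _ linForm_injective]
  exact he.ne_zero

lemma mem_insert_iff_iff {c : X} (hc : c ∉ T) (d : X) : (d ∈ insert c T ↔ d ∈ T) ↔ d ≠ c := by
  rw [Finset.mem_insert]
  by_cases h : d = c
  · subst h
    simp [hc]
  · simp [h]

lemma mem_erase_iff_iff {c : X} (hc : c ∈ T) (d : X) : (d ∈ T.erase c ↔ d ∈ T) ↔ d ≠ c := by
  rw [Finset.mem_erase]
  by_cases h : d = c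
  · subst h
    simp [hc]
  · simp [h]

lemma coeff_of_sdiff_eq {a b : X} (hab : a ≠ b) (hTU : T ⊆ U) (h : U \ T = {a, b}) :
    L.coeff p T U = 1 / area (L.cleaved p (insert a T)) + 1 / area (L.cleaved p (insert b T)) := by
  rw [coeff, if_pos ⟨hTU, by rw [h, Finset.card_pair hab]⟩, h, Finset.sum_pair hab]

/-- The same two intermediate resolutions seen from `U`, so that their areas can be read off from
the dual basis of `U`. -/
lemma coeff_of_sdiff_eq' {a b : X} (hab : a ≠ b) (hTU : T ⊆ U) (h : U \ T = {a, b}) :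
    L.coeff p T U = 1 / area (L.cleaved p (U.erase a)) + 1 / area (L.cleaved p (U.erase b)) := by
  have hU : U = insert a (insert b T) := by
    rw [← Finset.union_sdiff_of_subset hTU, h]
    ext
    simp
  have ha : a ∉ T := by
    have : a ∈ U \ T := by simp [h]
    exact (Finset.mem_sdiff.1 this).2
  have hb : b ∉ T := by
    have : b ∈ U \ T := by simp [h]
    exact (Finset.mem_sdiff.1 this).2
  have h1 : U.erase a = insert b T := by
    rw [hU, Finset.erase_insert (by simp [hab, ha])]
  have h2 : U.erase b = insert a T := by
    rw [hU, Finset.insert_comm, Finset.erase_insert (by simp [hab.symm, hb])]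
  rw [coeff_of_sdiff_eq hab hTU h, h1, h2, add_comm]

variable [Fintype X]

lemma IsDual.area_cleaved {c : X} {e : F → ZMod 2} (he : L.IsDual p T c e)
    (hT : L.IsSingleCircle T) (hS : ∀ d, (d ∈ S ↔ d ∈ T) ↔ d ≠ c) :
    area (L.cleaved p S) = algebraMap _ (FaceField F) (linForm e) := by
  rw [he.cleaved_eq hT hS, area_eq]

/-- The expansion of the areas cut off from `L_T` in terms of those cut off from `L_U`. -/
lemma IsSingleCircle.area_eq_sum (hU : L.IsSingleCircle U) {A : Finset X}
    (hA : ∀ d, (d ∈ U ↔ d ∈ T) ↔ d ∉ A) {e e' : X → F → ZMod 2}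
    (he : ∀ c, L.IsDual p T c (e c)) (he' : ∀ c, L.IsDual p U c (e' c)) {i : X} (hi : i ∈ A) :
    algebraMap _ (FaceField F) (linForm (e i)) = ∑ c ∈ A,
      algebraMap (ZMod 2) (FaceField F) (L.jump Tᶜ i (e c)) *
        algebraMap _ (FaceField F) (linForm (e' c)) := by
  -- Outside `A` the jumps of `L_U` are those of `L_T`, where `e i` jumps only at `i ∈ A`.
  have h := hU.eq_sum_of_isDual (A := A) (fun c _ => he' c) (he i).face_eq (he i).face_flip_eq
    (fun c hc => by
      rw [L.jump_congr ((hA c).2 hc), (he i).jump_eq, if_neg]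
      rintro rfl
      exact hc hi)
  rw [h, map_sum, map_sum]
  refine Finset.sum_congr rfl fun c hc => ?_
  rw [L.jump_compl_congr (fun h => (hA c).1 h hc), map_smul, Algebra.smul_def, map_mul,
    ← IsScalarTower.algebraMap_apply, (he c).jump_compl_symm (he i)]

/-- The composition of the differential with itself, between two generators. -/
lemma sum_coeff_mul_coeff [DecidablePred L.IsSingleCircle] (p : EdgeSide X Z)
    (hT : L.IsSingleCircle T) (hU : L.IsSingleCircle U) :
    ∑ S with L.IsSingleCircle S, L.coeff p T S * L.coeff p S U = 0 := by
  have h0 : ∀ S, L.coeff p T S * L.coeff p S U ≠ 0 →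
      (T ⊆ S ∧ (S \ T).card = 2) ∧ (S ⊆ U ∧ (U \ S).card = 2) := by
    intro S hS
    obtain ⟨h1, h2⟩ := mul_ne_zero_iff.1 hS
    exact ⟨by_contra fun h => h1 (if_neg h), by_contra fun h => h2 (if_neg h)⟩
  by_cases hTU : T ⊆ U ∧ (U \ T).card = 4
  swap
  · refine Finset.sum_eq_zero fun S _ => by_contra fun hS => hTU ?_
    obtain ⟨⟨h1, h2⟩, h3, h4⟩ := h0 S hS
    refine ⟨h1.trans h3, ?_⟩
    have k1 := Finset.card_sdiff_add_card_eq_card h1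
    have k2 := Finset.card_sdiff_add_card_eq_card h3
    have k3 := Finset.card_sdiff_add_card_eq_card (h1.trans h3)
    omega
  obtain ⟨hTU, hcard⟩ := hTU
  choose e he using fun c => hT.exists_isDual p c
  choose e' he' using fun c => hU.exists_isDual p c
  obtain ⟨a, A, haA, hA, hA3⟩ := Finset.card_eq_succ.1 hcard
  obtain ⟨b, c, d, hbc, hbd, hcd, rfl⟩ := Finset.card_eq_three.1 hA3
  simp only [Finset.mem_insert, Finset.mem_singleton, not_or] at haA
  obtain ⟨hab, hac, had⟩ := haA
  have hmem : ∀ i, i ∈ ({a, b, c, d} : Finset X) ↔ i ∈ U ∧ i ∉ T := fun i => by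
    rw [hA, Finset.mem_sdiff]
  let x : X → FaceField F := fun i => algebraMap _ (FaceField F) (linForm (e i))
  let y : X → FaceField F := fun i => algebraMap _ (FaceField F) (linForm (e' i))
  let m : X → X → FaceField F := fun i j =>
    algebraMap (ZMod 2) (FaceField F) (L.jump Tᶜ i (e j))
  have hx : ∀ i, x i ≠ 0 := fun i => (he i).linForm_ne_zero
  have hy : ∀ i, y i ≠ 0 := fun i => (he' i).linForm_ne_zero
  have hm : ∀ i j, m i j = 0 ∨ m i j = 1 := by
    intro i j
    have h : ∀ t : ZMod 2, t = 0 ∨ t = 1 := by decide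
    rcases h (L.jump Tᶜ i (e j)) with h | h <;> simp [m, h]
  have hmm : ∀ i j, m i j = m j i := fun i j => by
    simp only [m, (he i).jump_compl_symm (he j)]
  have hm0 : ∀ i, m i i = 0 := fun i => by simp only [m, (he i).jump_compl_self, map_zero]
  have hrow : ∀ i ∈ ({a, b, c, d} : Finset X),
      x i = m i a * y a + m i b * y b + m i c * y c + m i d * y d := by
    intro i hi
    refine (hU.area_eq_sum (A := {a, b, c, d}) (fun j => ?_) he he' hi).trans ?_
    · rw [hmem]
      have := @hTU j
      tauto
    · rw [Finset.sum_insert (by simp [*]), Finset.sum_insert (by simp [*]), Finset.sum_pair hcd]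
      simp only [m, y, add_assoc]
  -- The first coefficient is computed from `T`, the second from `U` by undoing the complementary
  -- pair `k`, `l`; `m i j` records whether the resolution in between is a single circle.
  have hterm : ∀ i ∈ ({a, b, c, d} : Finset X), ∀ j ∈ ({a, b, c, d} : Finset X), i ≠ j →
      ∀ k l, k ≠ l → ({a, b, c, d} : Finset X) \ {i, j} = {k, l} →
      (if L.IsSingleCircle (T ∪ {i, j}) then L.coeff p T (T ∪ {i, j}) * L.coeff p (T ∪ {i, j}) U
        else 0) = m i j * ((1 / x i + 1 / x j) * (1 / y k + 1 / y l)) := by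
    intro i hi j hj hij k l hkl h
    have hiT := ((hmem i).1 hi).2
    have hjT := ((hmem j).1 hj).2
    have hkl' : k ∈ ({k, l} : Finset X) ∧ l ∈ ({k, l} : Finset X) := by simp
    rw [← h, Finset.mem_sdiff, Finset.mem_sdiff] at hkl'
    have hk := ((hmem k).1 hkl'.1.1).1
    have hl := ((hmem l).1 hkl'.2.1).1
    have h1 := hT.isSingleCircle_iff (S := T ∪ {i, j}) hij (he j) (fun q => by
      simp only [Finset.mem_union, Finset.mem_insert, Finset.mem_singleton]
      by_cases hi' : q = i
      · simp [hi', hiT]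
      · by_cases hj' : q = j
        · simp [hj', hjT]
        · simp [hi', hj'])
    by_cases hs : L.jump Tᶜ i (e j) = 1
    · have hS1 : (T ∪ {i, j}) \ T = {i, j} := by
        rw [Finset.union_sdiff_cancel_left]
        simp [hiT, hjT]
      have hS2 : U \ (T ∪ {i, j}) = {k, l} := by
        rw [← h, hA, sdiff_sdiff_left]
        rfl
      have hSU : T ∪ {i, j} ⊆ U := by
        refine Finset.union_subset hTU fun q hq => ?_
        rw [Finset.mem_insert, Finset.mem_singleton] at hq
        rcases hq with rfl | rfl
        · exact ((hmem _).1 hi).1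
        · exact ((hmem _).1 hj).1
      rw [if_pos (h1.2 hs), coeff_of_sdiff_eq hij Finset.subset_union_left hS1,
        coeff_of_sdiff_eq' hkl hSU hS2, (he i).area_cleaved hT (mem_insert_iff_iff hiT),
        (he j).area_cleaved hT (mem_insert_iff_iff hjT),
        (he' k).area_cleaved hU (mem_erase_iff_iff hk),
        (he' l).area_cleaved hU (mem_erase_iff_iff hl)]
      simp only [m, x, y, hs, map_one, one_mul]
    · have h6 : ∀ t : ZMod 2, t ≠ 1 → t = 0 := by decide
      rw [if_neg (fun h => hs (h1.1 h))]
      simp only [m, h6 _ hs, map_zero, zero_mul]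
  clear_value x y m
  have hsd : ({a, b, c, d} : Finset X) \ {a, b} = {c, d} ∧
      ({a, b, c, d} : Finset X) \ {a, c} = {b, d} ∧ ({a, b, c, d} : Finset X) \ {a, d} = {b, c} ∧
      ({a, b, c, d} : Finset X) \ {b, c} = {a, d} ∧ ({a, b, c, d} : Finset X) \ {b, d} = {a, c} ∧
      ({a, b, c, d} : Finset X) \ {c, d} = {a, b} := by
    clear hterm hrow hmem hA hA3 hcard
    refine ⟨?_, ?_, ?_, ?_, ?_, ?_⟩ <;>
    · ext q
      simp only [Finset.mem_sdiff, Finset.mem_insert, Finset.mem_singleton]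
      grind
  obtain ⟨s1, s2, s3, s4, s5, s6⟩ := hsd
  have ma : a ∈ ({a, b, c, d} : Finset X) := by simp
  have mb : b ∈ ({a, b, c, d} : Finset X) := by simp
  have mc : c ∈ ({a, b, c, d} : Finset X) := by simp
  have md : d ∈ ({a, b, c, d} : Finset X) := by simp
  -- Only the sets `T ∪ B` with `B` a pair among the four crossings contribute.
  rw [Finset.sum_filter, ← Finset.sum_subset
    (Finset.subset_univ ((({a, b, c, d} : Finset X).powersetCard 2).image (T ∪ ·)))]
  · rw [Finset.sum_image, Finset.sum_powersetCard_two hab hac had hbc hbd hcd,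
      hterm a ma b mb hab c d hcd s1,
      hterm a ma c mc hac b d hbd s2,
      hterm a ma d md had b c hbc s3,
      hterm b mb c mc hbc a d had s4,
      hterm b mb d md hbd a c hac s5,
      hterm c mc d md hcd a b hab s6]
    · refine sum_inv_combination (hm _ _) (hm _ _) (hm _ _) (hm _ _) (hm _ _) (hm _ _) (hx _) (hx _)
        (hx _) (hx _) (hy _) (hy _) (hy _) (hy _) ?_ ?_ ?_ ?_
      · rw [hrow a ma, hm0, zero_mul, zero_add]
      · rw [hrow b mb, hm0, zero_mul, add_zero, hmm b a]
      · rw [hrow c mc, hm0, zero_mul, add_zero, hmm c a, hmm c b]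
      · rw [hrow d md, hm0, zero_mul, add_zero, hmm d a, hmm d b, hmm d c]
    · have hdis : ∀ B ∈ ({a, b, c, d} : Finset X).powersetCard 2, (T ∪ B) \ T = B := by
        intro B hB
        refine Finset.union_sdiff_cancel_left (Finset.disjoint_left.2 fun q hq hqB => ?_)
        exact ((hmem q).1 ((Finset.mem_powersetCard.1 hB).1 hqB)).2 hq
      intro B hB B' hB' h
      rw [← hdis B hB, ← hdis B' hB']
      exact congrArg (· \ T) h
  · intro S _ hS
    rw [ite_eq_right_iff]
    intro _
    by_contra h
    obtain ⟨⟨h1, h2⟩, h3, h4⟩ := h0 S h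
    refine hS (Finset.mem_image.2 ⟨S \ T, Finset.mem_powersetCard.2 ⟨?_, h2⟩,
      Finset.union_sdiff_of_subset h1⟩)
    rw [hA]
    exact Finset.sdiff_subset_sdiff h3 subset_rfl

lemma boundary_single_apply (p : EdgeSide X Z) {i j : ℤ} (T : L.Gen i) (T' : L.Gen j) :
    L.boundary p i j (Finsupp.single T 1) T' = L.coeff p T.1 T'.1 := by
  simp [boundary]

lemma boundary_comp_boundary (p : EdgeSide X Z) (i j k : ℤ) :
    L.boundary p j k ∘ₗ L.boundary p i j = 0 := by
  classical
  by_cases hij : i + 2 = j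
  swap
  · rw [L.boundary_eq_zero p i j hij, LinearMap.comp_zero]
  have : Fintype (L.Gen j) := Fintype.ofFinite _
  refine Finsupp.lhom_ext' fun T => LinearMap.ext_ring (Finsupp.ext fun U => ?_)
  have h := sum_coeff_mul_coeff p T.2.1 U.2.1
  have h1 : ∑ S with L.IsSingleCircle S, L.coeff p T.1 S * L.coeff p S U.1 =
      ∑ S : L.Gen j, L.coeff p T.1 S.1 * L.coeff p S.1 U.1 := by
    rw [← Finset.sum_subtype (Finset.univ.filter
      fun S : Finset X => L.IsSingleCircle S ∧ (S.card : ℤ) = j) (by simp)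
      (fun S => L.coeff p T.1 S * L.coeff p S U.1)]
    -- A single circle resolution of degree other than `j = i + 2` has coefficient zero in `∂T`.
    refine (Finset.sum_subset (fun S => by simp; tauto) fun S hS hS' => ?_).symm
    have h2 : ¬ (T.1 ⊆ S ∧ (S \ T.1).card = 2) := by
      rintro ⟨h2, h3⟩
      have h4 := Finset.card_sdiff_add_card_eq_card h2
      have h5 := T.2.2
      simp only [Finset.mem_filter, Finset.mem_univ, true_and] at hS hS'
      exact hS' ⟨hS, by omega⟩
    rw [coeff, if_neg h2, zero_mul]
  rw [h1] at h
  have h2 : L.boundary p j k (L.boundary p i j (Finsupp.single T 1)) U =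
      ∑ S : L.Gen j, L.coeff p T.1 S.1 * L.coeff p S.1 U.1 := by
    conv_lhs => rw [boundary, Finsupp.linearCombination_apply, Finsupp.sum_fintype _ _ (by simp),
      Finsupp.finsetSum_apply]
    simp [boundary_single_apply]
  exact h2.trans h

end Boundary

end LinkDiagram

namespace LinkDiagram

/-! ### Moving the marked point. -/

section FaceFieldEquiv

variable {F : Type*} [Fintype F]

lemma linForm_single [DecidableEq F] (f : F) :
    linForm (Pi.single f 1) = (MvPolynomial.X f : MvPolynomial F (ZMod 2)) := by
  simp [linForm]

/-- A linear involution of the linear forms extends to a field automorphism. -/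
lemma exists_ringEquiv_of_involutive (τ : (F → ZMod 2) →ₗ[ZMod 2] (F → ZMod 2))
    (hτ : Function.Involutive τ) :
    ∃ I : FaceField F ≃+* FaceField F, ∀ r, I (algebraMap _ (FaceField F) (linForm r)) =
      algebraMap _ (FaceField F) (linForm (τ r)) := by
  classical
  let σ : MvPolynomial F (ZMod 2) →ₐ[ZMod 2] MvPolynomial F (ZMod 2) :=
    MvPolynomial.aeval fun f => linForm (τ (Pi.single f 1))
  have hσ : ∀ r, σ (linForm r) = linForm (τ r) := by
    suffices h : σ.toLinearMap ∘ₗ linForm = linForm ∘ₗ τ from fun r => LinearMap.congr_fun h r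
    refine LinearMap.pi_ext' fun f => LinearMap.ext_ring ?_
    simp [linForm_single, σ]
  have hσσ : σ.comp σ = AlgHom.id _ _ := by
    refine MvPolynomial.algHom_ext fun f => ?_
    rw [AlgHom.comp_apply, ← linForm_single, hσ, hσ, hτ, AlgHom.id_apply]
  refine ⟨IsFractionRing.ringEquivOfRingEquiv (AlgEquiv.ofAlgHom σ σ hσσ hσσ).toRingEquiv,
    fun r => ?_⟩
  rw [IsFractionRing.ringEquivOfRingEquiv_algebraMap]
  exact congrArg _ (hσ r)

end FaceFieldEquiv

section MarkedPoint

variable {X Z F : Type*} {L : LinkDiagram X Z F} [DecidableEq X] {T : Finset X} {p : EdgeSide X Z}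

/-- The involution of the functions on the faces that moves the marked point from the faces
`b` (black) and `w` (white) to `b'` and `w'`. -/
def moveMarked (β : F → ZMod 2) (b b' w w' : F) : (F → ZMod 2) →ₗ[ZMod 2] (F → ZMod 2) where
  toFun r := r + (r b + r b') • β + (r w + r w') • (1 + β)
  map_add' r r' := by
    ext f
    simp only [Pi.add_apply, Pi.smul_apply, smul_eq_mul]
    ring
  map_smul' a r := by
    ext f
    simp only [Pi.add_apply, Pi.smul_apply, smul_eq_mul, RingHom.id_apply]
    ring

lemma moveMarked_apply (β : F → ZMod 2) (b b' w w' : F) (r : F → ZMod 2) :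
    moveMarked β b b' w w' r = r + (r b + r b') • β + (r w + r w') • (1 + β) := rfl

/-- The map exchanges the values at `b` and `b'` and those at `w` and `w'`, so a second application
adds the same correction again. -/
lemma moveMarked_involutive {β : F → ZMod 2} {b b' w w' : F} (hb : β b = 1) (hb' : β b' = 1)
    (hw : β w = 0) (hw' : β w' = 0) : Function.Involutive (moveMarked β b b' w w') := by
  intro r
  ext f
  simp only [moveMarked_apply, Pi.add_apply, Pi.smul_apply, smul_eq_mul, hb, hb', hw, hw',
    Pi.one_apply]
  generalize r b = x, r b' = y, r w = z, r w' = t, r f = u, β f = v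
  revert x y z t u v
  decide

/-- The correction, a combination of `β` and `1 + β`, changes no jump and makes the values at `b'`
and `w'` equal to those of `e` at `b` and `w`, which are zero. -/
lemma IsDual.moveMarked {p' : EdgeSide X Z} {c : X} {e β : F → ZMod 2} {b b' w w' : F}
    (he : L.IsDual p T c e) (hβ : ∀ s, L.cobound β s = 1) (hb' : β b' = 1) (hw' : β w' = 0)
    (hp : s(L.face p, L.face (L.flip p)) = s(b, w))
    (hp' : s(L.face p', L.face (L.flip p')) = s(b', w')) :
    L.IsDual p' T c (moveMarked β b b' w w' e) := by
  have hbw : e b = 0 ∧ e w = 0 := by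
    have h0 := he.face_eq
    have h1 := he.face_flip_eq
    rcases Sym2.eq_iff.1 hp with ⟨h, h'⟩ | ⟨h, h'⟩ <;> rw [h] at h0 <;> rw [h'] at h1
    · exact ⟨h0, h1⟩
    · exact ⟨h1, h0⟩
  have h1 : LinkDiagram.moveMarked β b b' w w' e b' = 0 := by
    simp [moveMarked_apply, hbw, hb', CharTwo.add_self_eq_zero]
  have h2 : LinkDiagram.moveMarked β b b' w w' e w' = 0 := by
    simp [moveMarked_apply, hbw, hw', CharTwo.add_self_eq_zero]
  have h3 : ∀ d, L.jump T d β = 0 := fun d => by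
    rw [L.jump_eq_cobound T d 0, hβ, hβ]
    rfl
  have h4 : ∀ d, L.jump T d 1 = 0 := fun d => by
    rw [L.jump_apply]
    rfl
  refine ⟨?_, ?_, fun d => ?_⟩
  · rcases Sym2.eq_iff.1 hp' with ⟨h, h'⟩ | ⟨h, h'⟩ <;> rw [h] <;> assumption
  · rcases Sym2.eq_iff.1 hp' with ⟨h, h'⟩ | ⟨h, h'⟩ <;> rw [h'] <;> assumption
  · rw [moveMarked_apply, map_add, map_add, map_smul, map_smul, map_add, h3, h4, he.jump_eq]
    simp

variable [Fintype X] [Fintype F]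

/-- The checkerboard coloring. -/
lemma IsSingleCircle.exists_coloring (hT : L.IsSingleCircle T) :
    ∃ β : F → ZMod 2, ∀ s, L.cobound β s = 1 := by
  obtain ⟨-, ⟨C⟩⟩ := Nat.card_eq_one_iff_unique.1 hT
  obtain ⟨p, -⟩ := Quot.exists_rep C
  obtain ⟨β, -, h⟩ := hT.exists_cobound_eq p (z := fun _ => 1) (fun _ => rfl) (fun _ => rfl)
  exact ⟨β, h⟩

/-- `T` serves only to provide the colouring; the involution depends on the colouring and the marked
faces, so one `I` fits every `S`. -/
lemma IsSingleCircle.exists_map_coeff (hT : L.IsSingleCircle T) (p p' : EdgeSide X Z) :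
    ∃ I : FaceField F ≃+* FaceField F, ∀ S, L.IsSingleCircle S → ∀ S',
      I (L.coeff p S S') = L.coeff p' S S' := by
  obtain ⟨β, hβ⟩ := hT.exists_coloring
  have hcol : ∀ p : EdgeSide X Z, ∃ b w, β b = 1 ∧ β w = 0 ∧
      s(L.face p, L.face (L.flip p)) = s(b, w) := by
    intro p
    have h : ∀ x y : ZMod 2, x + y = 1 → (x = 1 ∧ y = 0) ∨ (y = 1 ∧ x = 0) := by decide
    rcases h _ _ (hβ p) with ⟨h1, h2⟩ | ⟨h1, h2⟩
    · exact ⟨_, _, h1, h2, rfl⟩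
    · exact ⟨_, _, h1, h2, Sym2.eq_swap⟩
  obtain ⟨b, w, hb, hw, hp⟩ := hcol p
  obtain ⟨b', w', hb', hw', hp'⟩ := hcol p'
  obtain ⟨I, hI⟩ := exists_ringEquiv_of_involutive _ (moveMarked_involutive hb hb' hw hw')
  refine ⟨I, fun S hS S' => ?_⟩
  rw [coeff, coeff]
  split_ifs
  · rw [map_sum]
    refine Finset.sum_congr rfl fun c hc => ?_
    obtain ⟨e, he⟩ := hS.exists_isDual p c
    have hc' := mem_insert_iff_iff (Finset.mem_sdiff.1 hc).2
    rw [he.area_cleaved hS hc', (he.moveMarked hβ hb' hw' hp hp').area_cleaved hS hc', ← hI,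
      map_div₀, map_one]
  · exact map_zero I

end MarkedPoint

end LinkDiagram

/-! ### Extension of scalars and the isomorphism of complexes. -/

section ExtendScalars

open CategoryTheory ChangeOfRings

universe u v

variable {R S : Type u} [CommRing R] [CommRing S] (f : R →+* S) (ι : Type v)

open Classical in
/-- Extension of scalars of a free module. -/
noncomputable def ModuleCat.extendScalarsFinsupp :
    (ModuleCat.extendScalars f).obj (ModuleCat.of R (ι →₀ R)) ≅ ModuleCat.of S (ι →₀ S) :=
  letI := f.toAlgebra
  LinearEquiv.toModuleIso (TensorProduct.finsuppScalarRight R S S ι)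

lemma ModuleCat.extendScalarsFinsupp_one_tmul (m : ι →₀ R) :
    (ModuleCat.extendScalarsFinsupp f ι).hom ((1 : S) ⊗ₜ[R,f] m) =
      m.mapRange f (map_zero f) := by
  classical
  let := f.toAlgebra
  refine Finsupp.ext fun i => ?_
  refine (TensorProduct.finsuppScalarRight_apply_tmul_apply (R := R) (S := S) (1 : S) m i).trans ?_
  rw [Algebra.smul_def, mul_one]
  rfl

/-- Maps out of an extension of scalars are determined on the elements `1 ⊗ m`, where the square
reduces to `h`. -/
lemma ModuleCat.extendScalarsFinsupp_naturality {ι κ : Type v}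
    (φ : (ι →₀ R) →ₗ[R] (κ →₀ R)) (ψ : (ι →₀ S) →ₗ[S] (κ →₀ S))
    (h : ∀ m, ψ (m.mapRange f (map_zero f)) = (φ m).mapRange f (map_zero f)) :
    (ModuleCat.extendScalarsFinsupp f ι).hom ≫ ModuleCat.ofHom ψ =
      (ModuleCat.extendScalars f).map (ModuleCat.ofHom φ) ≫
        (ModuleCat.extendScalarsFinsupp f κ).hom := by
  refine ModuleCat.ExtendScalars.hom_ext fun m => ?_
  exact (congrArg ψ (ModuleCat.extendScalarsFinsupp_one_tmul f ι m)).trans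
    ((h m).trans (ModuleCat.extendScalarsFinsupp_one_tmul f κ (φ m)).symm)

end ExtendScalars

namespace LinkDiagram

section Iso

open CategoryTheory ChangeOfRings

variable {X Z F : Type*} {L : LinkDiagram X Z F} [DecidableEq X] [Fintype X] [Fintype F]

lemma boundary_apply (p : EdgeSide X Z) {i j : ℤ} [Fintype (L.Gen i)]
    (m : L.Gen i →₀ FaceField F) (T' : L.Gen j) :
    L.boundary p i j m T' = ∑ T : L.Gen i, m T * L.coeff p T.1 T'.1 := by
  rw [boundary, Finsupp.linearCombination_apply, Finsupp.sum_fintype _ _ (by simp),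
    Finsupp.finsetSum_apply]
  simp

lemma nonempty_extendScalars_CT_iso {p p' : EdgeSide X Z}
    (h : ∀ i j k : ℤ, L.boundary p j k ∘ₗ L.boundary p i j = 0)
    (h' : ∀ i j k : ℤ, L.boundary p' j k ∘ₗ L.boundary p' i j = 0)
    (I : FaceField F ≃+* FaceField F)
    (hI : ∀ S, L.IsSingleCircle S → ∀ S', I (L.coeff p S S') = L.coeff p' S S') :
    Nonempty (((ModuleCat.extendScalars (I : FaceField F →+* FaceField F)).mapHomologicalComplex
      _).obj (L.CT p h) ≅ L.CT p' h') := by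
  refine ⟨HomologicalComplex.Hom.isoOfComponents
    (fun i => ModuleCat.extendScalarsFinsupp (I : FaceField F →+* FaceField F) (L.Gen i))
    fun i j _ => ?_⟩
  have : Fintype (L.Gen i) := Fintype.ofFinite _
  refine ModuleCat.extendScalarsFinsupp_naturality _ _ _ fun m => Finsupp.ext fun T' => ?_
  rw [boundary_apply, Finsupp.mapRange_apply, boundary_apply, map_sum]
  refine Finset.sum_congr rfl fun T _ => ?_
  rw [map_mul, Finsupp.mapRange_apply]
  exact congrArg _ (hI _ T.2.1 _).symm

end Iso

end LinkDiagram

theorem mainTheorem3 {X Z F : Type*} [Fintype X] [DecidableEq X] [Finite Z] [Fintype F]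
    (L : LinkDiagram X Z F) :
    (∀ (p : EdgeSide X Z) (T T' : Finset X) (c₁ c₂ : X),
      L.IsSingleCircle T → L.IsSingleCircle T' → T ⊆ T' → c₁ ≠ c₂ → T' \ T = {c₁, c₂} →
        Nat.card (L.Circle (insert c₁ T)) = 2 ∧ Nat.card (L.Circle (insert c₂ T)) = 2 ∧
        LinkDiagram.area (L.cleaved p (insert c₁ T)) ≠ 0 ∧
        LinkDiagram.area (L.cleaved p (insert c₂ T)) ≠ 0 ∧
        L.coeff p T T' = 1 / LinkDiagram.area (L.cleaved p (insert c₁ T)) +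
          1 / LinkDiagram.area (L.cleaved p (insert c₂ T))) ∧
    ∃ h : ∀ (p : EdgeSide X Z) (i j k : ℤ), L.boundary p j k ∘ₗ L.boundary p i j = 0,
      ∀ p p' : EdgeSide X Z, ∃ I : LinkDiagram.FaceField F ≃+* LinkDiagram.FaceField F,
        Nonempty
          (((ModuleCat.extendScalars (I : LinkDiagram.FaceField F →+*
              LinkDiagram.FaceField F)).mapHomologicalComplex _).obj (L.CT p (h p)) ≅
            L.CT p' (h p')) := by
  refine ⟨fun p T T' c₁ c₂ hT hT' hTT' hc h => ?_,
    fun p i j k => LinkDiagram.boundary_comp_boundary p i j k, fun p p' => ?_⟩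
  · have hmem : ∀ c ∈ ({c₁, c₂} : Finset X), c ∉ T := fun c hc => by
      rw [← h, Finset.mem_sdiff] at hc
      exact hc.2
    have key : ∀ c ∈ ({c₁, c₂} : Finset X), Nat.card (L.Circle (insert c T)) = 2 ∧
        LinkDiagram.area (L.cleaved p (insert c T)) ≠ 0 := by
      intro c hc
      obtain ⟨e, he⟩ := hT.exists_isDual p c
      have hS := LinkDiagram.mem_insert_iff_iff (hmem c hc)
      refine ⟨he.card_circle_eq_two hT hS, ?_⟩
      rw [he.area_cleaved hT hS]
      exact he.linForm_ne_zero
    have k1 := key c₁ (by simp)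
    have k2 := key c₂ (by simp)
    exact ⟨k1.1, k2.1, k1.2, k2.2, LinkDiagram.coeff_of_sdiff_eq hc hTT' h⟩
  · by_cases hT : ∃ T, L.IsSingleCircle T
    · obtain ⟨T, hT⟩ := hT
      obtain ⟨I, hI⟩ := hT.exists_map_coeff p p'
      exact ⟨I, LinkDiagram.nonempty_extendScalars_CT_iso _ _ I hI⟩
    -- Without single circle resolutions both complexes are zero and any automorphism will do.
    · exact ⟨RingEquiv.refl _, LinkDiagram.nonempty_extendScalars_CT_iso _ _ _
        fun S hS => absurd ⟨S, hS⟩ hT⟩
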